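/- Let $d\in\mathbb N$. Fix functions $\phi_{(n)}\in C^\infty(\mathbb R^d;\mathbb R)$, $n\in\mathbb N$, with $\phi_{(n)}(\xi)=1$ for $|\xi|\le 2^{-n}$, $\phi_{(n)}(\xi)=0$ for $|\xi|>2^{n+1}$, and $\sup_n\|x^\beta\partial^\alpha\phi_{(n)}\|_{L^1}<\infty$ for all multi-indices $\alpha,\beta$. The dyadic partition of size $n$ consists of the Fourier multipliers $\Delta_0$ with symbol $\phi_{(n)}(\xi)$ and $\Delta_k$ with symbol $\phi_{(n)}(2^{-k}\xi)-\phi_{(n)}(2^{-(k-1)}\xi)$, $k\ge1$. For a given partition, $C^s_*$ is the space of (complex-valued) tempered distributions $u$ with $\|u\|_{C^s_*}=\sup_{q\ge0}2^{qs}\|\Delta_qu\|_{L^\infty}<\infty$; $H^s$ is the usual $L^2$-based Sobolev space. Let $\kappa:\mathbb R^d_1\to\mathbb R^d_2$ (two copies of $\mathbb R^d$) be a $C^1$ diffeomorphism with $\kappa'$ bounded and $|\det\kappa'(x)|\ge m_0>0$ for all $x$. Equip $\mathbb R^d_2$ with the partition of size $0$ and $\mathbb R^d_1$ with the partition of size $n_0$,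 and use these partitions for the norms of $C^s_*(\mathbb R^d_2)$ and $C^s_*(\mathbb R^d_1)$. Here $n_0\in\mathbb N$ and a width $\widetilde N\in\mathbb N$ are given as functions of $(m_0,\|\kappa'\|_{L^\infty})$ only; these functions are fixed once and for all and are otherwise arbitrary. For a tempered distribution $v$ on $\mathbb R^d_1$ put $[v]_p=\sum_{j\ge0,\ |j-p|\le\widetilde N}\Delta_jv$ (blocks of size $n_0$), and for $u$ on $\mathbb R^d_2$ put $u_p=\Delta_pu$ (blocks of size $0$). The global paracomposition is $$\kappa^*_gu=\sum_{p=0}^\infty[u_p\circ\kappa]_p .$$ Theorem. For every $s\in\mathbb R$ there is a function $\mathcal F$ with values in $[0,\infty)$, independent of $\kappa$, such that for every $\kappa$ and $m_0$ as above: (i) for every $u\in C^s_*(\mathbb R^d_2)$ the series defining $\kappa^*_gu$ converges in $\mathcal S'(\mathbb R^d_1)$, $\kappa^*_gu$ is uniquely determined, and $\|\kappa^*_gu\|_{C^s_*}\le\mathcal F(m_0,\|\kappa'\|_{L^\infty})\,\|u\|_{C^s_*}$; (ii) for every $u\in H^s(\mathbb R^d_2)$ the series defining $\kappa^*_gu$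 converges in $\mathcal S'(\mathbb R^d_1)$, $\kappa^*_gu$ is uniquely determined and belongs to $H^s(\mathbb R^d_1)$, and $\|\kappa^*_gu\|_{H^s}\le\mathcal F(m_0,\|\kappa'\|_{L^\infty})\,\|u\|_{H^s}$. -/

import Mathlib

open MeasureTheory TemperedDistribution
open scoped SchwartzMap ENNReal NNReal ContDiff

noncomputable section

namespace Paracomp

/-- The Euclidean space `ℝ^d`. -/
abbrev Eu (d : ℕ) : Type := EuclideanSpace ℝ (Fin d)

/-- A family `φ_(n)`, `n ∈ ℕ`, of smooth cut-off functions on `ℝ^d` with `φ_(n) = 1` on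
`|ξ| ≤ 2^(-n)`, `φ_(n) = 0` on `|ξ| > 2^(n+1)`, and weighted `L¹` bounds of all derivatives that
are uniform in `n`. -/
structure CutoffFamily (d : ℕ) where
  /-- the cut-off function of size `n` -/
  φ : ℕ → Eu d → ℝ
  smooth : ∀ n, ContDiff ℝ ∞ (φ n)
  eq_one : ∀ n ξ, ‖ξ‖ ≤ ((2 : ℝ) ^ n)⁻¹ → φ n ξ = 1
  eq_zero : ∀ n ξ, (2 : ℝ) ^ (n + 1) < ‖ξ‖ → φ n ξ = 0
  bound : ∀ k m : ℕ, ∃ C : ℝ, ∀ n, ∫ ξ, ‖ξ‖ ^ k * ‖iteratedFDeriv ℝ m (φ n) ξ‖ ≤ C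

variable {d : ℕ}

/-- The symbols of the dyadic partition of size `n`: `φ_(n)(ξ)` for `k = 0`, and
`φ_(n)(ξ / 2^k) - φ_(n)(ξ / 2^(k-1))` for `k ≥ 1`. -/
def CutoffFamily.dyadicSymbol (Φ : CutoffFamily d) (n : ℕ) : ℕ → Eu d → ℝ
  | 0, ξ => Φ.φ n ξ
  | k + 1, ξ => Φ.φ n (((2 : ℝ) ^ (k + 1))⁻¹ • ξ) - Φ.φ n (((2 : ℝ) ^ k)⁻¹ • ξ)

/-- The dyadic block `Δ_k` of the partition of size `n`: the Fourier multiplier with symbol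
`dyadicSymbol Φ n k`. The symbol is written for the Fourier transform `∫ e^{-i x·ξ} u(x) dx`, while
Mathlib's transform is `∫ e^{-2 π i x·ξ} u(x) dx`; hence the factor `2 π`. -/
def CutoffFamily.block (Φ : CutoffFamily d) (n k : ℕ) : 𝓢'(Eu d, ℂ) →L[ℂ] 𝓢'(Eu d, ℂ) :=
  fourierMultiplierCLM ℂ (fun ξ : Eu d => (Φ.dyadicSymbol n k ((2 * Real.pi) • ξ) : ℂ))

/-- The function `f` represents the tempered distribution `v`. (Such an `f` is unique up to
equality almost everywhere.) -/
def Represents (f : Eu d → ℂ) (v : 𝓢'(Eu d, ℂ)) : Prop :=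
  ∀ g : 𝓢(Eu d, ℂ), Integrable (fun x => g x * f x) ∧ v g = ∫ x, g x * f x

/-- The `L^p` norm of a tempered distribution; it is `∞` unless the distribution is represented by
a function of class `L^p`. -/
def distLpNorm (p : ℝ≥0∞) (v : 𝓢'(Eu d, ℂ)) : ℝ≥0∞ :=
  ⨅ (f : Eu d → ℂ) (_ : Represents f v), eLpNorm f p volume

/-- The Zygmund norm `sup_q 2^(q s) ‖Δ_q u‖_{L^∞}` taken with the partition of size `n`. The Zygmund
space `C^s_*` consists of the `u` of finite norm. -/
def zygmundNorm (Φ : CutoffFamily d) (n : ℕ) (s : ℝ) (u : 𝓢'(Eu d, ℂ)) : ℝ≥0∞ :=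
  ⨆ q : ℕ, ENNReal.ofReal ((2 : ℝ) ^ ((q : ℝ) * s)) * distLpNorm ∞ (Φ.block n q u)

/-- The Sobolev norm of `H^s`. -/
def sobolevNorm (s : ℝ) (u : 𝓢'(Eu d, ℂ)) : ℝ≥0∞ :=
  distLpNorm 2 (besselPotential (Eu d) ℂ s u)

/-- `w = v ∘ κ`, for a tempered distribution `v` that is a function. -/
def IsComposition (κ : Eu d → Eu d) (v w : 𝓢'(Eu d, ℂ)) : Prop :=
  ∃ f : Eu d → ℂ, Represents f v ∧ Represents (f ∘ κ) w

/-- The piece `[v]_p = ∑_{|j - p| ≤ N} Δ_j v`, `j ≥ 0`, for the partition of size `n`. -/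
def piece (Φ : CutoffFamily d) (n N p : ℕ) (v : 𝓢'(Eu d, ℂ)) : 𝓢'(Eu d, ℂ) :=
  ∑ j ∈ Finset.Icc (p - N) (p + N), Φ.block n j v

/-- `w` is the global paracomposition `κ_g^* u = ∑_{p ≥ 0} [u_p ∘ κ]_p`. Here `u_p = Δ_p u` is taken
with the partition of size `0`, the pieces `[·]_p` have width `N` and are taken with the partition
of size `n`, and the series converges in the space of tempered distributions. -/
def IsGlobalParacomposition (Φ : CutoffFamily d) (n N : ℕ) (κ : Eu d → Eu d)
    (u w : 𝓢'(Eu d, ℂ)) : Prop :=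
  ∃ v : ℕ → 𝓢'(Eu d, ℂ),
    (∀ p, IsComposition κ (Φ.block 0 p u) (v p)) ∧ HasSum (fun p => piece Φ n N p (v p)) w

end Paracomp

end

noncomputable section

namespace Paracomp

/-! ### Tempered distributions represented by functions -/

variable {d : ℕ}

/-! Nothing about the spectrum of `u_p ∘ κ` is needed: the projection `[·]_p` restores by force the
frequency localization at `2^p` that composition destroys. What remains is that composition with `κ`
is bounded on `L^∞` (with constant 1, as preimages of null sets are null) and on `L²` (with constant
`m₀^(-1/2)`, by change of variables). So `V_p = u_p ∘ κ` obeys the same dyadic bounds as `u_p`, and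
it suffices to sum `[V_p]_p`.

Zygmund case: all blocks with `j ≥ 1` are dilates of one multiplier, so they are uniformly bounded
on `L^∞`, and `Δ_q` meets only the pieces with `|p - q| ≤ T`, which gives the norm bound.
Convergence in `𝓢'` for arbitrary `s` holds because an annular symbol is divisible by `|ξ|^(2M)`:
each late piece is a fixed differential operator applied to an `L^∞` function smaller by `2^(-2Mp)`,
and these are summable for large `M` (`summable_piece_top`).

Sobolev case: conjugation by Bessel potentials replaces the block symbols by `2^{ps} ⟨ξ⟩^{-s}` times
themselves, which are still bounded and finitely overlapping (`IsDyadic.weighted`). Plancherel then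
gives two almost-orthogonality bounds, `IsDyadic.sum_norm_sq_le` to decompose `u` and
`IsDyadic.norm_sum_sq_le` to reassemble the pieces. Uniqueness holds because representatives are
unique almost everywhere and `κ` respects null sets. -/

theorem represents_toTemperedDistribution {p : ℝ≥0∞} [hp : Fact (1 ≤ p)]
    (F : Lp ℂ p (volume : Measure (Eu d))) : Represents F (Lp.toTemperedDistribution F) := by
  intro g
  have := ENNReal.HolderConjugate.inv_one_sub_inv' hp.out
  refine ⟨(Lp.memLp F).integrable_mul (q := (1 - p⁻¹)⁻¹) (g.memLp _ volume) |>.congr ?_, ?_⟩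
  · filter_upwards with x using mul_comm _ _
  · simp

theorem Represents.locallyIntegrable {f : Eu d → ℂ} {v : 𝓢'(Eu d, ℂ)} (hf : Represents f v) :
    LocallyIntegrable f := by
  intro x
  let b : ContDiffBump x := ⟨1, 2, one_pos, one_lt_two⟩
  have h₁ : HasCompactSupport (Complex.ofRealCLM ∘ b) := b.hasCompactSupport.comp_left rfl
  have h₂ : ContDiff ℝ ∞ (Complex.ofRealCLM ∘ b) := Complex.ofRealCLM.contDiff.comp b.contDiff
  refine ⟨Metric.closedBall x 1, Metric.closedBall_mem_nhds x one_pos, ?_⟩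
  -- The bump equals 1 on the unit ball, so there `f` coincides with an integrable product.
  refine (hf (h₁.toSchwartzMap h₂)).1.integrableOn.congr_fun (fun y hy => ?_)
    measurableSet_closedBall
  have : b y = 1 := b.one_of_mem_closedBall hy
  simp [this]

theorem Represents.ae_eq {f f' : Eu d → ℂ} {v : 𝓢'(Eu d, ℂ)} (hf : Represents f v)
    (hf' : Represents f' v) : f =ᵐ[volume] f' := by
  have h : f - f' =ᵐ[volume] 0 := by
    apply ae_eq_zero_of_integral_contDiff_smul_eq_zero
      (hf.locallyIntegrable.sub hf'.locallyIntegrable)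
    intro g hg hgc
    have h₁ : HasCompactSupport (Complex.ofRealCLM ∘ g) := hgc.comp_left rfl
    have h₂ : ContDiff ℝ ∞ (Complex.ofRealCLM ∘ g) := by fun_prop
    have e := (hf (h₁.toSchwartzMap h₂)).2.symm.trans (hf' (h₁.toSchwartzMap h₂)).2
    rw [← sub_eq_zero, ← integral_sub (hf _).1 (hf' _).1] at e
    rw [← e]
    refine integral_congr_ae (.of_forall fun x => ?_)
    simp [mul_sub]
  filter_upwards [h] with x hx
  simpa [sub_eq_zero] using hx

theorem distLpNorm_toTemperedDistribution {p : ℝ≥0∞} [Fact (1 ≤ p)]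
    (F : Lp ℂ p (volume : Measure (Eu d))) :
    distLpNorm p (Lp.toTemperedDistribution F) = ‖F‖ₑ := by
  rw [Lp.enorm_def]
  refine le_antisymm (iInf₂_le (F : Eu d → ℂ) (represents_toTemperedDistribution F)) (le_iInf₂ fun f hf => ?_)
  exact (eLpNorm_congr_ae ((represents_toTemperedDistribution F).ae_eq hf)).le

theorem exists_toTemperedDistribution_of_distLpNorm_lt_top {p : ℝ≥0∞} [Fact (1 ≤ p)]
    {v : 𝓢'(Eu d, ℂ)} (h : distLpNorm p v < ⊤) :
    ∃ F : Lp ℂ p (volume : Measure (Eu d)), v = Lp.toTemperedDistribution F := by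
  obtain ⟨f, hf⟩ := iInf_lt_iff.1 h
  obtain ⟨hf, hlt⟩ := iInf_lt_iff.1 hf
  have hm : MemLp f p volume := ⟨hf.locallyIntegrable.aestronglyMeasurable, hlt⟩
  refine ⟨hm.toLp f, ?_⟩
  ext g
  rw [(hf g).2, Lp.toTemperedDistribution_apply]
  refine integral_congr_ae ?_
  filter_upwards [hm.coeFn_toLp] with x hx
  simp [hx]

theorem toTemperedDistribution_injective {p : ℝ≥0∞} [Fact (1 ≤ p)] :
    Function.Injective
      (Lp.toTemperedDistribution : Lp ℂ p (volume : Measure (Eu d)) → 𝓢'(Eu d, ℂ)) := by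
  intro F G h
  refine Lp.ext ?_
  have := represents_toTemperedDistribution F
  rw [h] at this
  exact this.ae_eq (represents_toTemperedDistribution G)

/-! ### Composition with the diffeomorphism on `L^∞` and `L²` -/

section Composition

variable {κ : Eu d ≃ Eu d}

/-- The preimage of a null set under `κ` is its image under the differentiable map `κ.symm`, hence
null. This makes `f ∘ κ` meaningful for classes of functions modulo null sets. -/
theorem quasiMeasurePreserving_of_contDiff (hκ : ContDiff ℝ 1 κ) (hκ' : ContDiff ℝ 1 κ.symm) :
    Measure.QuasiMeasurePreserving κ (volume : Measure (Eu d)) volume := by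
  refine ⟨hκ.continuous.measurable, Measure.AbsolutelyContinuous.mk fun s hs h0 => ?_⟩
  rw [Measure.map_apply hκ.continuous.measurable hs, ← κ.image_symm_eq_preimage]
  exact addHaar_image_eq_zero_of_differentiableOn_of_addHaar_eq_zero volume
    (hκ'.differentiable one_ne_zero).differentiableOn h0

theorem lintegral_comp_le (hκ : ContDiff ℝ 1 κ) {m : ℝ} (hm : 0 < m)
    (hdet : ∀ x, m ≤ |(fderiv ℝ κ x).det|) (g : Eu d → ℝ≥0∞) :
    ∫⁻ x, g (κ x) ≤ ENNReal.ofReal m⁻¹ * ∫⁻ x, g x := by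
  have h := lintegral_image_eq_lintegral_abs_det_fderiv_mul (volume : Measure (Eu d))
    MeasurableSet.univ (f := κ) (f' := fderiv ℝ κ)
    (fun x _ => ((hκ.differentiable one_ne_zero) x).hasFDerivAt.hasFDerivWithinAt)
    κ.injective.injOn g
  rw [Set.image_univ, κ.range_eq_univ, Measure.restrict_univ] at h
  rw [h, ← lintegral_const_mul' _ _ ENNReal.ofReal_ne_top]
  refine lintegral_mono fun x => ?_
  rw [← mul_assoc, ← ENNReal.ofReal_mul (by positivity)]
  refine le_mul_of_one_le_left zero_le ?_
  rw [← ENNReal.ofReal_one]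
  refine ENNReal.ofReal_le_ofReal ?_
  rw [inv_mul_eq_div, le_div_iff₀ hm, one_mul]
  exact hdet x

theorem eLpNorm_two_comp_le (hκ : ContDiff ℝ 1 κ) {m : ℝ} (hm : 0 < m)
    (hdet : ∀ x, m ≤ |(fderiv ℝ κ x).det|) (f : Eu d → ℂ) :
    eLpNorm (f ∘ κ) 2 volume ≤ ENNReal.ofReal (m⁻¹ ^ (1 / 2 : ℝ)) * eLpNorm f 2 volume := by
  rw [eLpNorm_eq_lintegral_rpow_enorm_toReal (by norm_num) (by norm_num),
    eLpNorm_eq_lintegral_rpow_enorm_toReal (by norm_num) (by norm_num),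
    ← ENNReal.ofReal_rpow_of_nonneg (by positivity) (by norm_num)]
  simp only [ENNReal.toReal_ofNat]
  rw [← ENNReal.mul_rpow_of_nonneg _ _ (by norm_num)]
  exact ENNReal.rpow_le_rpow (lintegral_comp_le hκ hm hdet fun x => ‖f x‖ₑ ^ (2 : ℝ)) (by norm_num)

theorem eLpNorm_top_comp_le (hκ : ContDiff ℝ 1 κ) (hκ' : ContDiff ℝ 1 κ.symm) (f : Eu d → ℂ) :
    eLpNorm (f ∘ κ) ⊤ volume ≤ eLpNorm f ⊤ volume := by
  rw [eLpNorm_exponent_top, eLpNorm_exponent_top]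
  exact essSup_le_of_ae_le _ ((quasiMeasurePreserving_of_contDiff hκ hκ').ae
    (enorm_ae_le_eLpNormEssSup f volume))

theorem exists_isComposition {p : ℝ≥0∞} [Fact (1 ≤ p)] (hκ : ContDiff ℝ 1 κ)
    (hκ' : ContDiff ℝ 1 κ.symm) {A : ℝ} (hA : 0 ≤ A)
    (hnorm : ∀ f : Eu d → ℂ, eLpNorm (f ∘ κ) p volume ≤ ENNReal.ofReal A * eLpNorm f p volume)
    (F : Lp ℂ p (volume : Measure (Eu d))) :
    ∃ G : Lp ℂ p (volume : Measure (Eu d)),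
      IsComposition κ (Lp.toTemperedDistribution F) (Lp.toTemperedDistribution G) ∧
        ‖G‖ ≤ A * ‖F‖ := by
  have hm : MemLp (F ∘ κ) p volume :=
    ⟨(Lp.memLp F).1.comp_quasiMeasurePreserving (quasiMeasurePreserving_of_contDiff hκ hκ'),
      (hnorm F).trans_lt (ENNReal.mul_lt_top ENNReal.ofReal_lt_top (Lp.memLp F).2)⟩
  refine ⟨hm.toLp _, ⟨F, represents_toTemperedDistribution F, fun g => ?_⟩, ?_⟩
  · obtain ⟨h₁, h₂⟩ := represents_toTemperedDistribution (hm.toLp _) g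
    have e : (fun x => g x * hm.toLp _ x) =ᵐ[volume] fun x => g x * (F ∘ κ) x := by
      filter_upwards [hm.coeFn_toLp] with x hx
      rw [hx]
    exact ⟨h₁.congr e, h₂.trans (integral_congr_ae e)⟩
  · rw [Lp.norm_toLp, Lp.norm_def, ← ENNReal.toReal_ofReal hA, ← ENNReal.toReal_mul]
    exact ENNReal.toReal_mono
      (ENNReal.mul_lt_top ENNReal.ofReal_lt_top (Lp.memLp F).2).ne (hnorm F)

theorem IsComposition.unique (hκ : ContDiff ℝ 1 κ) (hκ' : ContDiff ℝ 1 κ.symm)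
    {v w w' : 𝓢'(Eu d, ℂ)} (h : IsComposition κ v w) (h' : IsComposition κ v w') : w' = w := by
  obtain ⟨f, hf, hfw⟩ := h
  obtain ⟨f', hf', hfw'⟩ := h'
  ext g
  rw [(hfw g).2, (hfw' g).2]
  refine integral_congr_ae ?_
  filter_upwards [(quasiMeasurePreserving_of_contDiff hκ hκ').ae (hf.ae_eq hf')] with x hx
  simp [hx]

theorem IsGlobalParacomposition.unique {Φ : CutoffFamily d} {n N : ℕ} (hκ : ContDiff ℝ 1 κ)
    (hκ' : ContDiff ℝ 1 κ.symm) {u w w' : 𝓢'(Eu d, ℂ)} (h : IsGlobalParacomposition Φ n N κ u w)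
    (h' : IsGlobalParacomposition Φ n N κ u w') : w' = w := by
  obtain ⟨v, hv, hs⟩ := h
  obtain ⟨v', hv', hs'⟩ := h'
  obtain rfl : v' = v := funext fun p => (hv p).unique hκ hκ' (hv' p)
  exact hs'.unique hs

end Composition

/-! ### Fourier multipliers on `L^∞` -/

open FourierTransform

/-- The dilate `ξ ↦ σ (c • ξ)` of a Schwartz function. -/
def dilate (c : ℝ) (hc : c ≠ 0) (σ : 𝓢(Eu d, ℂ)) : 𝓢(Eu d, ℂ) :=
  SchwartzMap.compCLMOfContinuousLinearEquiv ℂ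
    (ContinuousLinearEquiv.smulLeft (Units.mk0 c hc) : Eu d ≃L[ℝ] Eu d) σ

@[simp]
theorem dilate_apply (c : ℝ) (hc : c ≠ 0) (σ : 𝓢(Eu d, ℂ)) (ξ : Eu d) :
    dilate c hc σ ξ = σ (c • ξ) := rfl

theorem fourier_dilate_apply (c : ℝ) (hc : c ≠ 0) (σ : 𝓢(Eu d, ℂ)) (x : Eu d) :
    𝓕 (dilate c hc σ) x = |(c ^ d)⁻¹| • 𝓕 σ (c⁻¹ • x) := by
  simp only [SchwartzMap.fourier_coe, Real.fourier_eq]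
  have := Measure.integral_comp_smul (volume : Measure (Eu d))
    (fun v => Real.fourierChar (-inner ℝ v (c⁻¹ • x)) • σ v) c
  rw [finrank_euclideanSpace_fin] at this
  rw [← this]
  refine integral_congr_ae (.of_forall fun v => ?_)
  simp [inner_smul_left, inner_smul_right, hc]

/-- Dilation rescales the kernel without changing its `L¹` norm, so one constant serves all dyadic
scales. -/
theorem integral_norm_fourier_dilate (c : ℝ) (hc : c ≠ 0) (σ : 𝓢(Eu d, ℂ)) :
    ∫ x, ‖𝓕 (dilate c hc σ) x‖ = ∫ x, ‖𝓕 σ x‖ := by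
  simp only [fourier_dilate_apply, norm_smul, norm_abs_eq_norm]
  rw [integral_const_mul, Measure.integral_comp_smul volume (fun x => ‖𝓕 σ x‖) c⁻¹,
    finrank_euclideanSpace_fin, smul_eq_mul, ← mul_assoc, Real.norm_eq_abs, ← abs_mul]
  have : (c ^ d)⁻¹ * (c⁻¹ ^ d)⁻¹ = 1 := by field_simp; simp [hc]
  rw [this, abs_one, one_mul]

theorem fourier_smulLeftCLM_fourierInv_apply (σ g : 𝓢(Eu d, ℂ)) (x : Eu d) :
    𝓕 (SchwartzMap.smulLeftCLM ℂ σ (𝓕⁻ g)) x = ∫ y, 𝓕 σ (x - y) * g y := by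
  have h : SchwartzMap.smulLeftCLM ℂ σ (𝓕⁻ g) =
      𝓕⁻ (SchwartzMap.convolution (ContinuousLinearMap.mul ℂ ℂ) (𝓕 σ) g) := by
    ext ξ
    have e (f : 𝓢(Eu d, ℂ)) : 𝓕⁻ f ξ = 𝓕 f (-ξ) := by
      rw [SchwartzMap.fourierInv_apply_eq]; simp
    rw [e, SchwartzMap.fourier_convolution, SchwartzMap.pairing_apply_apply, ← e, ← e,
      SchwartzMap.smulLeftCLM_apply_apply σ.hasTemperateGrowth]
    simp
  rw [h, FourierTransform.fourier_fourierInv_eq, SchwartzMap.convolution_apply,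
    ← MeasureTheory.convolution_flip]
  rfl

/-- Fourier multipliers with Schwartz symbol act on `L^∞`, with norm at most the `L¹` norm of the
kernel. -/
theorem exists_fourierMultiplierCLM_top (σ : 𝓢(Eu d, ℂ))
    (F : Lp ℂ ⊤ (volume : Measure (Eu d))) :
    ∃ G : Lp ℂ ⊤ (volume : Measure (Eu d)),
      fourierMultiplierCLM ℂ σ (Lp.toTemperedDistribution F) = Lp.toTemperedDistribution G ∧
        ‖G‖ ≤ (∫ x, ‖𝓕 σ x‖) * ‖F‖ := by
  set k := 𝓕 σ
  have hF : ∀ᵐ x, ‖F x‖ ≤ ‖F‖ := by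
    rw [Lp.norm_def, eLpNorm_exponent_top]
    filter_upwards [enorm_ae_le_eLpNormEssSup F volume] with x hx
    have := ENNReal.toReal_mono (by simpa using (Lp.memLp F).2.ne) hx
    simpa using this
  have hFm := (Lp.memLp F).1
  have hk (y : Eu d) : Integrable fun x => k (x - y) := k.integrable.comp_sub_right y
  have hbound (y : Eu d) : ‖∫ x, k (x - y) * F x‖ ≤ (∫ x, ‖k x‖) * ‖F‖ := by
    rw [← integral_sub_right_eq_self (fun x => ‖k x‖) y, ← integral_mul_const]
    refine norm_integral_le_of_norm_le ((hk y).norm.mul_const _) ?_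
    filter_upwards [hF] with x hx
    rw [norm_mul]
    gcongr
  have hmeas : AEStronglyMeasurable (fun y => ∫ x, k (x - y) * F x) volume := by
    refine AEStronglyMeasurable.integral_prod_right' (f := fun z : Eu d × Eu d =>
      k (z.2 - z.1) * F z.2) ?_
    exact (k.continuous.comp (continuous_snd.sub continuous_fst)).aestronglyMeasurable.mul
      hFm.comp_snd
  have hm : MemLp (fun y => ∫ x, k (x - y) * F x) ⊤ volume :=
    memLp_top_of_bound hmeas _ (.of_forall hbound)
  refine ⟨hm.toLp _, ?_, ?_⟩
  · ext g
    rw [fourierMultiplierCLM_apply_apply, Lp.toTemperedDistribution_apply,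
      Lp.toTemperedDistribution_apply]
    simp only [fourier_smulLeftCLM_fourierInv_apply, smul_eq_mul]
    have hint : Integrable (fun z : Eu d × Eu d => k (z.1 - z.2) * g z.2 * F z.1)
        (volume.prod volume) := by
      refine Integrable.mul_bdd (c := ‖F‖) ?_ hFm.comp_fst
        (Measure.quasiMeasurePreserving_fst.ae hF)
      refine (Real.integrable_prod_sub (ContinuousLinearMap.mul ℂ ℂ) k.integrable
        g.integrable).mono' ?_ (.of_forall fun z => ?_)
      · exact ((k.continuous.comp (continuous_fst.sub continuous_snd)).mul
          (g.continuous.comp continuous_snd)).aestronglyMeasurable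
      · simp
    -- The multiplier acts by transposition on test functions; Fubini moves the kernel from `g` onto
    -- `F`.
    calc ∫ x, (∫ y, k (x - y) * g y) * F x
        = ∫ x, ∫ y, k (x - y) * g y * F x := by simp only [integral_mul_const]
      _ = ∫ y, ∫ x, k (x - y) * g y * F x := integral_integral_swap hint
      _ = ∫ y, g y * ∫ x, k (x - y) * F x := by
        refine integral_congr_ae (.of_forall fun y => ?_)
        simp only [← integral_const_mul]
        refine integral_congr_ae (.of_forall fun x => ?_)
        ring
      _ = _ := by
        refine integral_congr_ae ?_
        filter_upwards [hm.coeFn_toLp] with y hy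
        rw [hy]
  · rw [Lp.norm_toLp, eLpNorm_exponent_top]
    exact ENNReal.toReal_le_of_le_ofReal (by positivity)
      (eLpNormEssSup_le_of_ae_bound (.of_forall hbound))

theorem exists_fourierMultiplierCLM_comp_smul_top (σ : 𝓢(Eu d, ℂ)) {c : ℝ} (hc : c ≠ 0)
    (F : Lp ℂ ⊤ (volume : Measure (Eu d))) :
    ∃ G : Lp ℂ ⊤ (volume : Measure (Eu d)),
      fourierMultiplierCLM ℂ (fun ξ => σ (c • ξ)) (Lp.toTemperedDistribution F) =
        Lp.toTemperedDistribution G ∧ ‖G‖ ≤ (∫ x, ‖𝓕 σ x‖) * ‖F‖ := by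
  have := exists_fourierMultiplierCLM_top (dilate c hc σ) F
  rwa [integral_norm_fourier_dilate] at this

/-- A family of bounded symbols `a p` living on the frequencies `ξ` with
`(1 + |ξ|²)^{1/2} ≈ 2^p`. -/
structure IsDyadic (R : ℕ) (B : ℝ) (a : ℕ → Eu d → ℂ) : Prop where
  growth : ∀ p, (a p).HasTemperateGrowth
  bound : ∀ p ξ, ‖a p ξ‖ ≤ B
  le_weight : ∀ p ξ, a p ξ ≠ 0 → (2 : ℝ) ^ p ≤ 2 ^ R * √(1 + ‖ξ‖ ^ 2)
  weight_le : ∀ p ξ, a p ξ ≠ 0 → √(1 + ‖ξ‖ ^ 2) ≤ 2 ^ R * 2 ^ p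

/-! ### Finitely overlapping families of symbols -/

namespace IsDyadic

variable {R R' : ℕ} {B B' : ℝ} {a b : ℕ → Eu d → ℂ}

theorem nonneg (ha : IsDyadic R B a) : 0 ≤ B := (norm_nonneg _).trans (ha.bound 0 0)

theorem le_add (ha : IsDyadic R B a) (hb : IsDyadic R' B' b) {p q : ℕ} {ξ : Eu d}
    (hp : a p ξ ≠ 0) (hq : b q ξ ≠ 0) : p ≤ q + (R + R') := by
  have h : (2 : ℝ) ^ p ≤ 2 ^ (q + (R + R')) := by
    calc (2 : ℝ) ^ p ≤ 2 ^ R * √(1 + ‖ξ‖ ^ 2) := ha.le_weight p ξ hp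
      _ ≤ 2 ^ R * (2 ^ R' * 2 ^ q) := by gcongr; exact hb.weight_le q ξ hq
      _ = _ := by ring
  exact (pow_le_pow_iff_right₀ one_lt_two).1 h

/-- At a given `ξ` all active indices lie within `2R` of one another, so at most `4R + 1` terms
survive. -/
theorem sum_sq_le (ha : IsDyadic R B a) (P : Finset ℕ) (ξ : Eu d) :
    ∑ p ∈ P, ‖a p ξ‖ ^ 2 ≤ (4 * R + 1) * B ^ 2 := by
  classical
  rw [← Finset.sum_filter_of_ne (p := fun p => a p ξ ≠ 0) (fun p _ h => by simpa using h)]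
  rcases (P.filter fun p => a p ξ ≠ 0).eq_empty_or_nonempty with h | ⟨q, hq⟩
  · rw [h, Finset.sum_empty]; positivity
  have hsub : (P.filter fun p => a p ξ ≠ 0) ⊆ Finset.Icc (q - 2 * R) (q + 2 * R) := by
    intro p hp
    have h₁ := ha.le_add ha (Finset.mem_filter.1 hp).2 (Finset.mem_filter.1 hq).2
    have h₂ := ha.le_add ha (Finset.mem_filter.1 hq).2 (Finset.mem_filter.1 hp).2
    rw [Finset.mem_Icc]; omega
  have hcard : (P.filter fun p => a p ξ ≠ 0).card ≤ 4 * R + 1 := by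
    refine (Finset.card_le_card hsub).trans ?_
    rw [Nat.card_Icc]; omega
  calc ∑ p ∈ P with a p ξ ≠ 0, ‖a p ξ‖ ^ 2
      ≤ (P.filter fun p => a p ξ ≠ 0).card • B ^ 2 :=
        Finset.sum_le_card_nsmul _ _ _ fun p _ => by gcongr; exact ha.bound p ξ
    _ ≤ _ := by
      rw [nsmul_eq_mul]
      gcongr
      exact_mod_cast hcard

/-- Overlapping blocks `∑_{|j - p| ≤ N} a j`. -/
theorem sum_Icc (ha : IsDyadic R B a) (N : ℕ) :
    IsDyadic (R + N) ((2 * N + 1) * B)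
      (fun p ξ => ∑ j ∈ Finset.Icc (p - N) (p + N), a j ξ) where
  growth p := Function.HasTemperateGrowth.sum fun j _ => ha.growth j
  bound p ξ := by
    refine (norm_sum_le_of_le _ fun j _ => ha.bound j ξ).trans ?_
    rw [Finset.sum_const, nsmul_eq_mul, Nat.card_Icc]
    have := ha.nonneg
    gcongr
    have : p + N + 1 - (p - N) ≤ 2 * N + 1 := by omega
    exact_mod_cast this
  le_weight p ξ h := by
    obtain ⟨j, hj, hne⟩ := Finset.exists_ne_zero_of_sum_ne_zero h
    rw [Finset.mem_Icc] at hj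
    calc (2 : ℝ) ^ p ≤ 2 ^ (N + j) := pow_le_pow_right₀ one_le_two (by omega)
      _ = 2 ^ N * 2 ^ j := pow_add _ _ _
      _ ≤ 2 ^ N * (2 ^ R * √(1 + ‖ξ‖ ^ 2)) := by gcongr; exact ha.le_weight j ξ hne
      _ = _ := by ring
  weight_le p ξ h := by
    obtain ⟨j, hj, hne⟩ := Finset.exists_ne_zero_of_sum_ne_zero h
    rw [Finset.mem_Icc] at hj
    calc √(1 + ‖ξ‖ ^ 2) ≤ 2 ^ R * 2 ^ j := ha.weight_le j ξ hne
      _ ≤ 2 ^ R * 2 ^ (p + N) := by gcongr; exacts [one_le_two, hj.2]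
      _ = _ := by ring

theorem rpow_div_le {t u : ℝ} (ht : 0 < t) (hu : 0 < u) (h₁ : t ≤ 2 ^ R * u)
    (h₂ : u ≤ 2 ^ R * t) (s : ℝ) : t ^ s * u ^ (-s) ≤ 2 ^ (R * |s|) := by
  have hp : (0 : ℝ) < 2 ^ R := by positivity
  rw [Real.rpow_mul two_pos.le, Real.rpow_natCast]
  rcases le_total 0 s with hs | hs
  · rw [abs_of_nonneg hs, Real.rpow_neg hu.le, ← div_eq_mul_inv, ← Real.div_rpow ht.le hu.le]
    exact Real.rpow_le_rpow (by positivity) ((div_le_iff₀ hu).2 h₁) hs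
  · rw [abs_of_nonpos hs, mul_comm]
    nth_rw 2 [← neg_neg s]
    rw [Real.rpow_neg ht.le, ← div_eq_mul_inv, ← Real.div_rpow hu.le ht.le]
    exact Real.rpow_le_rpow (by positivity) ((div_le_iff₀ ht).2 h₂) (neg_nonneg.2 hs)

/-- Multiplication by `2^{ps} (1 + |ξ|²)^{-s/2}` preserves dyadic families. -/
theorem weighted (ha : IsDyadic R B a) (s : ℝ) :
    IsDyadic R (2 ^ (R * |s|) * B)
      (fun p ξ => (((2 : ℝ) ^ (p * s) : ℝ) : ℂ) *
        ((((1 + ‖ξ‖ ^ 2) ^ (-s / 2) : ℝ) : ℂ) * a p ξ)) where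
  growth p := by
    have h := ha.growth p
    fun_prop
  bound p ξ := by
    rcases eq_or_ne (a p ξ) 0 with h0 | h0
    · have := ha.nonneg
      rw [h0, mul_zero, mul_zero, norm_zero]; positivity
    rw [← mul_assoc, norm_mul]
    refine mul_le_mul ?_ (ha.bound p ξ) (norm_nonneg _) (by positivity)
    rw [← Complex.ofReal_mul, Complex.norm_real, Real.norm_of_nonneg (by positivity)]
    have := rpow_div_le (by positivity) (by positivity) (ha.le_weight p ξ h0)
      (ha.weight_le p ξ h0) s
    rw [Real.sqrt_eq_rpow, ← Real.rpow_mul (by positivity), ← Real.rpow_natCast,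
      ← Real.rpow_mul two_pos.le] at this
    rwa [show -s / 2 = 1 / 2 * -s by ring]
  le_weight p ξ h := ha.le_weight p ξ (right_ne_zero_of_mul (right_ne_zero_of_mul h))
  weight_le p ξ h := ha.weight_le p ξ (right_ne_zero_of_mul (right_ne_zero_of_mul h))

end IsDyadic

/-! ### Supports and smoothness of the dyadic symbols -/

theorem sqrt_one_add_sq_le {n k : ℕ} {t : ℝ} (ht : 0 ≤ t) (h : t ≤ 2 ^ (n + 1) * 2 ^ k) :
    √(1 + t ^ 2) ≤ 2 ^ (n + 4) * 2 ^ k := by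
  have h1 : (1 : ℝ) ≤ 2 ^ (n + 1) * 2 ^ k :=
    one_le_mul_of_one_le_of_one_le (one_le_pow₀ one_le_two) (one_le_pow₀ one_le_two)
  have h2 : (2 : ℝ) ^ (n + 4) * 2 ^ k = 8 * (2 ^ (n + 1) * 2 ^ k) := by ring
  rw [h2, Real.sqrt_le_left (by positivity)]
  nlinarith

namespace CutoffFamily

variable (Φ : CutoffFamily d) (n : ℕ)

theorem hasCompactSupport_comp_smul {c : ℝ} (hc : 0 < c) :
    HasCompactSupport fun ξ : Eu d => (Φ.φ n (c • ξ) : ℂ) := by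
  refine HasCompactSupport.intro (isCompact_closedBall 0 (2 ^ (n + 1) / c)) fun ξ hξ => ?_
  rw [Φ.eq_zero, Complex.ofReal_zero]
  rw [mem_closedBall_zero_iff, not_le, div_lt_iff₀ hc] at hξ
  rwa [norm_smul, Real.norm_of_nonneg hc.le, mul_comm]

theorem contDiff_comp_smul (c : ℝ) : ContDiff ℝ ∞ fun ξ : Eu d => (Φ.φ n (c • ξ) : ℂ) := by
  have := Φ.smooth n
  exact Complex.ofRealCLM.contDiff.comp (this.comp (contDiff_const_smul c))

/-- The symbol of the lowest block. -/
def lowSymbol : 𝓢(Eu d, ℂ) :=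
  (Φ.hasCompactSupport_comp_smul n Real.two_pi_pos).toSchwartzMap (Φ.contDiff_comp_smul n _)

/-- The symbol from which all other blocks arise by dilation. -/
def annulusSymbol : 𝓢(Eu d, ℂ) :=
  Φ.lowSymbol n - dilate 2 two_ne_zero (Φ.lowSymbol n)

@[simp]
theorem lowSymbol_apply (ξ : Eu d) : Φ.lowSymbol n ξ = Φ.φ n ((2 * Real.pi) • ξ) := rfl

theorem annulusSymbol_apply (ξ : Eu d) : Φ.annulusSymbol n ξ =
    Φ.φ n ((2 * Real.pi) • ξ) - Φ.φ n ((2 * Real.pi) • (2 : ℝ) • ξ) := rfl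

/-- The symbol of the `k`-th block, in the normalization of Mathlib's Fourier transform. -/
def symbol (k : ℕ) (ξ : Eu d) : ℂ := Φ.dyadicSymbol n k ((2 * Real.pi) • ξ)

theorem symbol_zero : Φ.symbol n 0 = Φ.lowSymbol n := rfl

theorem symbol_of_pos {k : ℕ} (hk : 1 ≤ k) :
    Φ.symbol n k = fun ξ => Φ.annulusSymbol n (((2 : ℝ) ^ k)⁻¹ • ξ) := by
  obtain ⟨k, rfl⟩ := Nat.exists_eq_add_of_le' hk
  ext ξ
  rw [symbol, dyadicSymbol, annulusSymbol_apply, Complex.ofReal_sub]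
  rw [smul_comm (2 * Real.pi), show (2 * Real.pi) • (2 : ℝ) • ((2 : ℝ) ^ (k + 1))⁻¹ • ξ =
    ((2 : ℝ) ^ k)⁻¹ • (2 * Real.pi) • ξ by
      simp only [smul_smul]; congr 1; rw [pow_succ]; field_simp]

theorem block_eq (k : ℕ) : Φ.block n k = fourierMultiplierCLM ℂ (Φ.symbol n k) := rfl

theorem norm_le_of_lowSymbol_ne_zero {ξ : Eu d} (h : Φ.lowSymbol n ξ ≠ 0) :
    ‖ξ‖ ≤ 2 ^ (n + 1) := by
  by_contra! hξ
  refine h ?_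
  rw [lowSymbol_apply, Φ.eq_zero, Complex.ofReal_zero]
  rw [norm_smul, Real.norm_of_nonneg (by positivity)]
  nlinarith [Real.pi_gt_three, norm_nonneg ξ]

theorem annulusSymbol_eq_zero_of_norm_le {ξ : Eu d} (h : ‖ξ‖ ≤ (2 ^ (n + 4))⁻¹) :
    Φ.annulusSymbol n ξ = 0 := by
  -- The larger of the two arguments has norm `4π‖ξ‖ ≤ 16‖ξ‖`; this is the source of the `4` in `n +
  -- 4`.
  have h' : 16 * ‖ξ‖ ≤ (2 ^ n)⁻¹ := by
    calc 16 * ‖ξ‖ ≤ 16 * (2 ^ (n + 4))⁻¹ := by gcongr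
      _ = _ := by rw [pow_add, mul_inv]; ring
  rw [annulusSymbol_apply, Φ.eq_one, Φ.eq_one, sub_self]
  all_goals
    simp only [norm_smul, Real.norm_of_nonneg Real.two_pi_pos.le, Real.norm_ofNat]
    refine le_trans ?_ h'
    nlinarith [Real.pi_lt_four, norm_nonneg ξ]

theorem norm_le_of_annulusSymbol_ne_zero {ξ : Eu d} (h : Φ.annulusSymbol n ξ ≠ 0) :
    ‖ξ‖ ≤ 2 ^ (n + 1) := by
  by_contra! hξ
  refine h ?_
  rw [annulusSymbol_apply, Φ.eq_zero, Φ.eq_zero, sub_self]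
  all_goals
    simp only [norm_smul, Real.norm_of_nonneg Real.two_pi_pos.le, Real.norm_ofNat]
    nlinarith [Real.pi_gt_three, norm_nonneg ξ]

theorem exists_isDyadic_symbol : ∃ B : ℝ, IsDyadic (n + 4) B (Φ.symbol n) := by
  have hb (σ : 𝓢(Eu d, ℂ)) (ξ) : ‖σ ξ‖ ≤ SchwartzMap.seminorm ℝ 0 0 σ :=
    SchwartzMap.norm_le_seminorm ℝ σ ξ
  refine ⟨SchwartzMap.seminorm ℝ 0 0 (Φ.lowSymbol n) +
    SchwartzMap.seminorm ℝ 0 0 (Φ.annulusSymbol n), fun k => ?_, fun k ξ => ?_, fun k ξ h => ?_,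
    fun k ξ h => ?_⟩
  all_goals rcases Nat.eq_zero_or_pos k with rfl | hk
  · exact (Φ.lowSymbol n).hasTemperateGrowth
  · rw [symbol_of_pos _ _ hk]
    exact (dilate _ (by positivity) (Φ.annulusSymbol n)).hasTemperateGrowth
  · exact (hb (Φ.lowSymbol n) ξ).trans (le_add_of_nonneg_right (apply_nonneg _ _))
  · rw [symbol_of_pos _ _ hk]
    exact (hb _ _).trans (le_add_of_nonneg_left (apply_nonneg _ _))
  · rw [pow_zero]
    refine one_le_mul_of_one_le_of_one_le (one_le_pow₀ one_le_two) ?_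
    rw [Real.one_le_sqrt]; simp
  · rw [symbol_of_pos _ _ hk] at h
    have h1 : (2 ^ (n + 4))⁻¹ < ‖((2 : ℝ) ^ k)⁻¹ • ξ‖ := by
      by_contra! h'
      exact h (Φ.annulusSymbol_eq_zero_of_norm_le n h')
    rw [norm_smul, Real.norm_of_nonneg (by positivity), inv_mul_eq_div, lt_div_iff₀ (by positivity),
      inv_mul_lt_iff₀ (by positivity)] at h1
    refine h1.le.trans ?_
    gcongr
    exact Real.le_sqrt_of_sq_le (by simp)
  · have h1 := Φ.norm_le_of_lowSymbol_ne_zero n h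
    exact sqrt_one_add_sq_le (k := 0) (norm_nonneg _) (by simpa using h1)
  · rw [symbol_of_pos _ _ hk] at h
    have h1 := Φ.norm_le_of_annulusSymbol_ne_zero n h
    rw [norm_smul, Real.norm_of_nonneg (by positivity), inv_mul_le_iff₀ (by positivity)] at h1
    exact sqrt_one_add_sq_le (norm_nonneg _) (h1.trans_eq (mul_comm _ _))

/-- The symbol of the pieces `[·]_p`. -/
def pieceSymbol (N p : ℕ) (ξ : Eu d) : ℂ := ∑ j ∈ Finset.Icc (p - N) (p + N), Φ.symbol n j ξ

theorem exists_isDyadic_pieceSymbol (N : ℕ) :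
    ∃ B : ℝ, IsDyadic (n + 4 + N) B (Φ.pieceSymbol n N) :=
  let ⟨_, hB⟩ := Φ.exists_isDyadic_symbol n
  ⟨_, hB.sum_Icc N⟩

theorem hasTemperateGrowth_symbol (k : ℕ) : (Φ.symbol n k).HasTemperateGrowth :=
  let ⟨_, hB⟩ := Φ.exists_isDyadic_symbol n
  hB.growth k

theorem piece_eq (N p : ℕ) (v : 𝓢'(Eu d, ℂ)) :
    piece Φ n N p v = fourierMultiplierCLM ℂ (Φ.pieceSymbol n N p) v := by
  have := fourierMultiplierCLM_sum ℂ (s := Finset.Icc (p - N) (p + N))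
    (fun j _ => Φ.hasTemperateGrowth_symbol n j)
  rw [show Φ.pieceSymbol n N p = fun ξ => ∑ j ∈ Finset.Icc (p - N) (p + N), Φ.symbol n j ξ from rfl,
    this, piece]
  simp [block_eq]

/-- The annular symbol vanishes near the origin, so its quotient by `|ξ|^(2M)` remains smooth with
compact support. The factor extracts negative powers of the frequency. -/
theorem exists_annulusSymbol_eq_norm_pow_mul (M : ℕ) : ∃ τ : 𝓢(Eu d, ℂ),
    ∀ ξ, Φ.annulusSymbol n ξ = ((‖ξ‖ ^ 2) ^ M : ℝ) * τ ξ := by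
  have h₁ : HasCompactSupport fun ξ : Eu d =>
      Φ.annulusSymbol n ξ / (((‖ξ‖ ^ 2) ^ M : ℝ) : ℂ) := by
    refine HasCompactSupport.intro (isCompact_closedBall 0 (2 ^ (n + 1))) fun ξ hξ => ?_
    rw [mem_closedBall_zero_iff] at hξ
    by_contra h
    exact hξ (Φ.norm_le_of_annulusSymbol_ne_zero n (left_ne_zero_of_mul h))
  have h₂ : ContDiff ℝ ∞ fun ξ : Eu d =>
      Φ.annulusSymbol n ξ / (((‖ξ‖ ^ 2) ^ M : ℝ) : ℂ) := by
    rw [contDiff_iff_contDiffAt]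
    intro ξ
    rcases eq_or_ne ξ 0 with rfl | hξ
    · refine (contDiffAt_const (c := (0 : ℂ))).congr_of_eventuallyEq ?_
      filter_upwards [Metric.closedBall_mem_nhds (0 : Eu d)
        (inv_pos.2 (pow_pos two_pos (n + 4)))] with ξ hξ
      rw [Φ.annulusSymbol_eq_zero_of_norm_le n (mem_closedBall_zero_iff.1 hξ), zero_div]
    · simp only [div_eq_mul_inv]
      refine ((Φ.annulusSymbol n).smooth ⊤).contDiffAt.mul (ContDiffAt.inv ?_ ?_)
      · exact (Complex.ofRealCLM.contDiff.comp ((contDiff_norm_sq ℝ).pow M)).contDiffAt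
      · have := norm_pos_iff.2 hξ
        exact_mod_cast (by positivity : (‖ξ‖ ^ 2) ^ M ≠ 0)
  refine ⟨h₁.toSchwartzMap h₂, fun ξ => ?_⟩
  change _ = _ * (Φ.annulusSymbol n ξ / (((‖ξ‖ ^ 2) ^ M : ℝ) : ℂ))
  rcases eq_or_ne ξ 0 with rfl | hξ
  · rw [Φ.annulusSymbol_eq_zero_of_norm_le n (by simp), zero_div, mul_zero]
  · have := norm_pos_iff.2 hξ
    have : (((‖ξ‖ ^ 2) ^ M : ℝ) : ℂ) ≠ 0 := by
      exact_mod_cast (by positivity : (‖ξ‖ ^ 2) ^ M ≠ 0)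
    field_simp

end CutoffFamily

/-! ### The estimate on Zygmund spaces -/

theorem fourierMultiplierCLM_eq_zero_of_mul_eq_zero {a b : Eu d → ℂ} (ha : a.HasTemperateGrowth)
    (hb : b.HasTemperateGrowth) (hab : ∀ ξ, a ξ * b ξ = 0) (v : 𝓢'(Eu d, ℂ)) :
    fourierMultiplierCLM ℂ b (fourierMultiplierCLM ℂ a v) = 0 := by
  rw [fourierMultiplierCLM_fourierMultiplierCLM_apply ha hb,
    show a * b = fun _ => 0 from funext hab, fourierMultiplierCLM_const]
  simp

theorem hasTemperateGrowth_norm_sq_pow (M : ℕ) :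
    (fun ξ : Eu d => (((‖ξ‖ ^ 2) ^ M : ℝ) : ℂ)).HasTemperateGrowth :=
  Function.HasTemperateGrowth.comp Function.Complex.hasTemperateGrowth_ofReal
    ((Function.hasTemperateGrowth_norm_sq (Eu d)).pow M)

namespace CutoffFamily

variable (Φ : CutoffFamily d) (n : ℕ)

theorem exists_block_top : ∃ C : ℝ, 0 ≤ C ∧ ∀ (j : ℕ) (F : Lp ℂ ⊤ (volume : Measure (Eu d))),
    ∃ G : Lp ℂ ⊤ (volume : Measure (Eu d)),
      Φ.block n j (Lp.toTemperedDistribution F) = Lp.toTemperedDistribution G ∧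
        ‖G‖ ≤ C * ‖F‖ := by
  refine ⟨(∫ x, ‖𝓕 (Φ.lowSymbol n) x‖) + ∫ x, ‖𝓕 (Φ.annulusSymbol n) x‖, by positivity,
    fun j F => ?_⟩
  rw [block_eq]
  rcases Nat.eq_zero_or_pos j with rfl | hj
  · obtain ⟨G, hG, hn⟩ := exists_fourierMultiplierCLM_top (Φ.lowSymbol n) F
    refine ⟨G, hG, hn.trans ?_⟩
    gcongr
    exact le_add_of_nonneg_right (by positivity)
  · rw [symbol_of_pos _ _ hj]
    obtain ⟨G, hG, hn⟩ := exists_fourierMultiplierCLM_comp_smul_top (Φ.annulusSymbol n)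
      (by positivity : ((2 : ℝ) ^ j)⁻¹ ≠ 0) F
    refine ⟨G, hG, hn.trans ?_⟩
    gcongr
    exact le_add_of_nonneg_left (by positivity)

/-- At scale `2^j` the factorization of the symbol gains `2^(-2Mj)`, at the price of `|ξ|^(2M)`,
which does not depend on `j` and acts continuously on `𝓢'`. -/
theorem exists_block_top_eq_fourierMultiplierCLM (M : ℕ) : ∃ C : ℝ, 0 ≤ C ∧
    ∀ (j : ℕ), 1 ≤ j → ∀ (F : Lp ℂ ⊤ (volume : Measure (Eu d))),
      ∃ G : Lp ℂ ⊤ (volume : Measure (Eu d)),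
        Φ.block n j (Lp.toTemperedDistribution F) =
          fourierMultiplierCLM ℂ (fun ξ => (((‖ξ‖ ^ 2) ^ M : ℝ) : ℂ))
            (Lp.toTemperedDistribution G) ∧
        ‖G‖ ≤ C * (((2 : ℝ) ^ j)⁻¹) ^ (2 * M) * ‖F‖ := by
  obtain ⟨τ, hτ⟩ := Φ.exists_annulusSymbol_eq_norm_pow_mul n M
  refine ⟨∫ x, ‖𝓕 τ x‖, by positivity, fun j hj F => ?_⟩
  have hc : ((2 : ℝ) ^ j)⁻¹ ≠ 0 := by positivity
  obtain ⟨G, hG, hn⟩ := exists_fourierMultiplierCLM_comp_smul_top τ hc F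
  set r : ℝ := (((2 : ℝ) ^ j)⁻¹) ^ (2 * M)
  have hg : (fun ξ => τ (((2 : ℝ) ^ j)⁻¹ • ξ)).HasTemperateGrowth :=
    (dilate _ hc τ).hasTemperateGrowth
  refine ⟨(r : ℂ) • G, ?_, ?_⟩
  · rw [← Lp.toTemperedDistributionCLM_apply ((r : ℂ) • G), map_smul, map_smul, Lp.toTemperedDistributionCLM_apply,
      ← hG, fourierMultiplierCLM_fourierMultiplierCLM_apply hg (hasTemperateGrowth_norm_sq_pow M),
      block_eq, symbol_of_pos _ _ hj, ← smul_apply,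
      ← fourierMultiplierCLM_smul (hg.mul (hasTemperateGrowth_norm_sq_pow M))]
    congr 2
    ext ξ
    rw [hτ, norm_smul, Real.norm_of_nonneg (by positivity)]
    simp only [Pi.smul_apply, Pi.mul_apply, smul_eq_mul, r]
    push_cast
    ring
  · rw [norm_smul, Complex.norm_real, Real.norm_of_nonneg (by positivity)]
    calc r * ‖G‖ ≤ r * ((∫ x, ‖𝓕 τ x‖) * ‖F‖) := by gcongr
      _ = _ := by ring

theorem summable_piece_top (N : ℕ) {s A : ℝ} (V : ℕ → Lp ℂ ⊤ (volume : Measure (Eu d)))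
    (hV : ∀ p : ℕ, ‖V p‖ ≤ A * (2 : ℝ) ^ (-(p * s))) :
    Summable fun p => piece Φ n N p (Lp.toTemperedDistribution (V p)) := by
  have hA : 0 ≤ A := nonneg_of_mul_nonneg_left ((norm_nonneg _).trans (hV 0)) (by positivity)
  -- With `M ≥ 0` this gives `2M + s ≥ 1`, so the terms decay at least like `2^(-p)`.
  obtain ⟨M, hM⟩ := exists_nat_ge (1 - s)
  obtain ⟨C, hC, hG⟩ := Φ.exists_block_top_eq_fourierMultiplierCLM n M
  choose G hG hGn using hG
  -- Dropping the first `N + 1` terms leaves only blocks `j ≥ 1`; the block `j = 0` is not annular.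
  rw [← summable_nat_add_iff (N + 1)]
  let W (p : ℕ) : Lp ℂ ⊤ (volume : Measure (Eu d)) :=
    ∑ j ∈ (Finset.Icc (p + (N + 1) - N) (p + (N + 1) + N)).attach,
      G j (by have := Finset.mem_Icc.1 j.2; omega) (V (p + (N + 1)))
  have hW : Summable W := by
    refine Summable.of_norm_bounded (g := fun p : ℕ =>
      (2 * N + 1) * (C * A * (2 : ℝ) ^ (-((N + 1) * s))) * (1 / 2) ^ p)
      ((summable_geometric_of_lt_one (by norm_num) (by norm_num)).mul_left _) fun p => ?_
    refine (norm_sum_le_of_le (n := fun _ => C * A * (2 : ℝ) ^ (-((N + 1) * s)) * (1 / 2) ^ p)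
      _ fun j _ => (hGn _ _ _).trans ?_).trans ?_
    · have hj : p ≤ j := by have := Finset.mem_Icc.1 j.2; omega
      have h1 : (((2 : ℝ) ^ (j : ℕ))⁻¹) ^ (2 * M) ≤ (2 : ℝ) ^ (-((p : ℝ) * (2 * M))) := by
        calc (((2 : ℝ) ^ (j : ℕ))⁻¹) ^ (2 * M) ≤ (((2 : ℝ) ^ p)⁻¹) ^ (2 * M) := by
              gcongr; exact one_le_two
          _ = _ := by
            rw [inv_pow, ← pow_mul, Real.rpow_neg two_pos.le, ← Real.rpow_natCast]
            push_cast; rfl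
      have h2 : (2 : ℝ) ^ (-((p : ℝ) * (2 * M))) * (2 : ℝ) ^ (-(((p + (N + 1) : ℕ) : ℝ) * s)) ≤
          (2 : ℝ) ^ (-((N + 1) * s)) * (1 / 2) ^ p := by
        rw [one_div, inv_pow, ← Real.rpow_natCast, ← Real.rpow_neg two_pos.le,
          ← Real.rpow_add two_pos, ← Real.rpow_add two_pos]
        refine Real.rpow_le_rpow_of_exponent_le one_le_two ?_
        push_cast
        have : (p : ℝ) * 1 ≤ p * (2 * M + s) := by
          gcongr
          have : (0 : ℝ) ≤ M := by positivity
          linarith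
        linarith
      calc C * (((2 : ℝ) ^ (j : ℕ))⁻¹) ^ (2 * M) * ‖V (p + (N + 1))‖
          ≤ C * (2 : ℝ) ^ (-((p : ℝ) * (2 * M))) *
            (A * (2 : ℝ) ^ (-(((p + (N + 1) : ℕ) : ℝ) * s))) := by
            gcongr; exact hV _
        _ = C * A * ((2 : ℝ) ^ (-((p : ℝ) * (2 * M))) *
            (2 : ℝ) ^ (-(((p + (N + 1) : ℕ) : ℝ) * s))) := by ring
        _ ≤ C * A * ((2 : ℝ) ^ (-((N + 1) * s)) * (1 / 2) ^ p) := by gcongr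
        _ = _ := by ring
    · rw [Finset.sum_const, Finset.card_attach, nsmul_eq_mul, Nat.card_Icc, ← mul_assoc]
      gcongr
      have : p + (N + 1) + N + 1 - (p + (N + 1) - N) ≤ 2 * N + 1 := by omega
      exact_mod_cast this
  have h := (hW.map (Lp.toTemperedDistributionCLM ℂ (volume : Measure (Eu d)) ⊤)
    (ContinuousLinearMap.continuous _)).map
    (fourierMultiplierCLM ℂ (fun ξ : Eu d => (((‖ξ‖ ^ 2) ^ M : ℝ) : ℂ)))
    (ContinuousLinearMap.continuous _)
  refine h.congr fun p => ?_
  rw [piece, ← Finset.sum_attach]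
  simp only [W, Function.comp_apply, map_sum, Lp.toTemperedDistributionCLM_apply, ← hG]

/-- The threshold is the sum of the dyadic widths `n + 4` of a block and `n + 4 + N` of a piece;
beyond it the symbols have disjoint supports. -/
theorem block_piece_eq_zero (N : ℕ) {p q : ℕ} (h : q + (2 * n + 8 + N) < p ∨
    p + (2 * n + 8 + N) < q) (v : 𝓢'(Eu d, ℂ)) : Φ.block n q (piece Φ n N p v) = 0 := by
  obtain ⟨B, hB⟩ := Φ.exists_isDyadic_symbol n
  obtain ⟨B', hB'⟩ := Φ.exists_isDyadic_pieceSymbol n N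
  rw [piece_eq, block_eq]
  refine fourierMultiplierCLM_eq_zero_of_mul_eq_zero (hB'.growth p) (hB.growth q) (fun ξ => ?_) v
  by_contra hne
  have hp := left_ne_zero_of_mul hne
  have hq := right_ne_zero_of_mul hne
  have h1 := hB.le_add hB' hq hp
  have h2 := hB'.le_add hB hp hq
  omega

theorem exists_block_piece_top (N : ℕ) : ∃ C : ℝ, 0 ≤ C ∧
    ∀ (q p : ℕ) (F : Lp ℂ ⊤ (volume : Measure (Eu d))),
      ∃ G : Lp ℂ ⊤ (volume : Measure (Eu d)),
        Φ.block n q (piece Φ n N p (Lp.toTemperedDistribution F)) =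
          Lp.toTemperedDistribution G ∧ ‖G‖ ≤ C * ‖F‖ := by
  obtain ⟨C, hC, hG⟩ := Φ.exists_block_top n
  choose G hG hGn using hG
  refine ⟨(2 * N + 1) * (C * C), by positivity, fun q p F =>
    ⟨∑ j ∈ Finset.Icc (p - N) (p + N), G q (G j F), ?_, ?_⟩⟩
  · rw [piece, map_sum, ← Lp.toTemperedDistributionCLM_apply (∑ j ∈ _, _), map_sum]
    simp only [Lp.toTemperedDistributionCLM_apply, hG]
  · refine (norm_sum_le_of_le (n := fun _ => C * C * ‖F‖) _ fun j _ => ?_).trans ?_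
    · calc ‖G q (G j F)‖ ≤ C * ‖G j F‖ := hGn _ _
        _ ≤ C * (C * ‖F‖) := by gcongr; exact hGn _ _
        _ = _ := by ring
    · rw [Finset.sum_const, nsmul_eq_mul, Nat.card_Icc, ← mul_assoc]
      gcongr
      have : p + N + 1 - (p - N) ≤ 2 * N + 1 := by omega
      exact_mod_cast this

theorem exists_zygmundNorm_tsum_piece_le (N : ℕ) (s : ℝ) : ∃ K : ℝ, 0 ≤ K ∧
    ∀ (A : ℝ) (V : ℕ → Lp ℂ ⊤ (volume : Measure (Eu d))) (w : 𝓢'(Eu d, ℂ)),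
      (∀ p : ℕ, ‖V p‖ ≤ A * (2 : ℝ) ^ (-(p * s))) →
      HasSum (fun p => piece Φ n N p (Lp.toTemperedDistribution (V p))) w →
      zygmundNorm Φ n s w ≤ ENNReal.ofReal (K * A) := by
  obtain ⟨C, hC, hG⟩ := Φ.exists_block_piece_top n N
  choose G hG hGn using hG
  set T := 2 * n + 8 + N
  refine ⟨(2 * T + 1) * (C * (2 : ℝ) ^ (T * |s|)), by positivity, fun A V w hV hw => ?_⟩
  have hA : 0 ≤ A := nonneg_of_mul_nonneg_left ((norm_nonneg _).trans (hV 0)) (by positivity)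
  refine iSup_le fun q => ?_
  have hq : Φ.block n q w = Lp.toTemperedDistribution
      (∑ p ∈ Finset.Icc (q - T) (q + T), G q p (V p)) := by
    have h1 := hw.map (Φ.block n q) (Φ.block n q).continuous
    have h2 : HasSum (fun p => Φ.block n q (piece Φ n N p (Lp.toTemperedDistribution (V p))))
        (∑ p ∈ Finset.Icc (q - T) (q + T),
          Φ.block n q (piece Φ n N p (Lp.toTemperedDistribution (V p)))) :=
      hasSum_sum_of_ne_finset_zero (fun p hp => Φ.block_piece_eq_zero n N (by rw [Finset.mem_Icc] at hp; omega) _)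
    rw [HasSum.unique h1 h2, ← Lp.toTemperedDistributionCLM_apply, map_sum]
    simp only [Lp.toTemperedDistributionCLM_apply, hG]
  rw [hq, distLpNorm_toTemperedDistribution, ← ofReal_norm,
    ← ENNReal.ofReal_mul (by positivity)]
  refine ENNReal.ofReal_le_ofReal ?_
  have hsum : ‖∑ p ∈ Finset.Icc (q - T) (q + T), G q p (V p)‖ ≤
      (2 * T + 1) * (C * (A * ((2 : ℝ) ^ (T * |s|) * (2 : ℝ) ^ (-(q * s))))) := by
    refine (norm_sum_le_of_le (n := fun _ =>
      C * (A * ((2 : ℝ) ^ (T * |s|) * (2 : ℝ) ^ (-(q * s))))) _ fun p hp => ?_).trans ?_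
    · refine (hGn _ _ _).trans ?_
      gcongr
      refine (hV p).trans ?_
      gcongr
      rw [← Real.rpow_add two_pos]
      refine Real.rpow_le_rpow_of_exponent_le one_le_two ?_
      rw [Finset.mem_Icc] at hp
      have h1 : (q : ℝ) ≤ p + T := by exact_mod_cast (by omega : q ≤ p + T)
      have h2 : (p : ℝ) ≤ q + T := by exact_mod_cast hp.2
      -- Replacing the weight at `p` by the one at `q` costs at most `2^(T|s|)`, for either sign of
      -- `s`.
      have h3 : |(q - p : ℝ)| ≤ T := abs_le.2 ⟨by linarith, by linarith⟩
      have h4 : (q - p : ℝ) * s ≤ T * |s| := by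
        refine (le_abs_self _).trans ?_
        rw [abs_mul]
        gcongr
      linarith
    · rw [Finset.sum_const, nsmul_eq_mul, Nat.card_Icc]
      gcongr
      have : q + T + 1 - (q - T) ≤ 2 * T + 1 := by omega
      exact_mod_cast this
  calc (2 : ℝ) ^ (q * s) * ‖∑ p ∈ Finset.Icc (q - T) (q + T), G q p (V p)‖
      ≤ (2 : ℝ) ^ (q * s) *
        ((2 * T + 1) * (C * (A * ((2 : ℝ) ^ (T * |s|) * (2 : ℝ) ^ (-(q * s)))))) := by gcongr
    _ = (2 * T + 1) * (C * (2 : ℝ) ^ (T * |s|)) * A *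
        ((2 : ℝ) ^ (q * s) * (2 : ℝ) ^ (-(q * s))) := by ring
    _ = _ := by rw [← Real.rpow_add two_pos, add_neg_cancel, Real.rpow_zero, mul_one]

end CutoffFamily

/-- The global paracomposition is bounded on Zygmund spaces. -/
theorem exists_paracomposition_zygmund (Φ : CutoffFamily d) (n N : ℕ) (s : ℝ) :
    ∃ K : ℝ, 0 ≤ K ∧ ∀ κ : Eu d ≃ Eu d, ContDiff ℝ 1 κ → ContDiff ℝ 1 κ.symm →
      ∀ u : 𝓢'(Eu d, ℂ), zygmundNorm Φ 0 s u < ⊤ →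
        ∃ w : 𝓢'(Eu d, ℂ), IsGlobalParacomposition Φ n N κ u w ∧
          zygmundNorm Φ n s w ≤ ENNReal.ofReal K * zygmundNorm Φ 0 s u := by
  obtain ⟨K, hK, h⟩ := Φ.exists_zygmundNorm_tsum_piece_le n N s
  refine ⟨K, hK, fun κ hκ hκ' u hu => ?_⟩
  have hblock (p : ℕ) : ∃ V : Lp ℂ ⊤ (volume : Measure (Eu d)),
      IsComposition κ (Φ.block 0 p u) (Lp.toTemperedDistribution V) ∧
        ‖V‖ ≤ (zygmundNorm Φ 0 s u).toReal * (2 : ℝ) ^ (-(p * s)) := by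
    have hle : ENNReal.ofReal ((2 : ℝ) ^ ((p : ℝ) * s)) * distLpNorm ⊤ (Φ.block 0 p u) ≤
        zygmundNorm Φ 0 s u :=
      le_iSup (fun p : ℕ => ENNReal.ofReal ((2 : ℝ) ^ ((p : ℝ) * s)) *
        distLpNorm ⊤ (Φ.block 0 p u)) p
    have hpos : (0 : ℝ) < (2 : ℝ) ^ ((p : ℝ) * s) := by positivity
    have hlt : distLpNorm ⊤ (Φ.block 0 p u) < ⊤ := by
      by_contra! htop
      rw [top_le_iff.1 htop, ENNReal.mul_top (by simpa using hpos)] at hle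
      exact hu.ne (top_le_iff.1 hle)
    obtain ⟨F, hF⟩ := exists_toTemperedDistribution_of_distLpNorm_lt_top hlt
    obtain ⟨V, hV, hVn⟩ := exists_isComposition hκ hκ' zero_le_one
      (fun f => by simpa using eLpNorm_top_comp_le hκ hκ' f) F
    refine ⟨V, hF ▸ hV, hVn.trans ?_⟩
    rw [hF, distLpNorm_toTemperedDistribution, ← ofReal_norm,
      ← ENNReal.ofReal_mul hpos.le, ENNReal.ofReal_le_iff_le_toReal hu.ne] at hle
    rw [one_mul, Real.rpow_neg two_pos.le, ← div_eq_mul_inv, le_div_iff₀ hpos, mul_comm]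
    exact hle
  choose V hV hVn using hblock
  obtain ⟨w, hw⟩ := Φ.summable_piece_top n N V hVn
  refine ⟨w, ⟨_, hV, hw⟩, (h _ V w hVn hw).trans ?_⟩
  rw [ENNReal.ofReal_mul hK, ENNReal.ofReal_toReal hu.ne]

/-! ### The estimate on Sobolev spaces -/

theorem integrable_norm_sq (F : Lp ℂ 2 (volume : Measure (Eu d))) :
    Integrable fun x => ‖F x‖ ^ 2 :=
  (memLp_two_iff_integrable_sq_norm (Lp.memLp F).1).1 (Lp.memLp F)

theorem norm_sq_eq_integral (F : Lp ℂ 2 (volume : Measure (Eu d))) :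
    ‖F‖ ^ 2 = ∫ x, ‖F x‖ ^ 2 := by
  have h := inner_self_eq_norm_sq_to_K (𝕜 := ℂ) F
  rw [L2.inner_def] at h
  simp only [inner_self_eq_norm_sq_to_K] at h
  have e : (∫ x, ((‖F x‖ : ℂ)) ^ 2) = ((∫ x, ‖F x‖ ^ 2 : ℝ) : ℂ) := by
    rw [← integral_complex_ofReal]; push_cast; rfl
  refine Complex.ofReal_injective ?_
  rw [← e, Complex.ofReal_pow]
  exact h.symm

theorem exists_fourierMultiplierCLM_two {g : Eu d → ℂ} (hg : g.HasTemperateGrowth) {B : ℝ}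
    (hB : ∀ ξ, ‖g ξ‖ ≤ B) (F : Lp ℂ 2 (volume : Measure (Eu d))) :
    ∃ G : Lp ℂ 2 (volume : Measure (Eu d)),
      fourierMultiplierCLM ℂ g (Lp.toTemperedDistribution F) = Lp.toTemperedDistribution G ∧
        ∀ᵐ ξ, 𝓕 G ξ = g ξ * 𝓕 F ξ := by
  have hm : MemLp g ⊤ (volume : Measure (Eu d)) :=
    memLp_top_of_bound hg.1.continuous.aestronglyMeasurable B (.of_forall hB)
  refine ⟨𝓕⁻ ((hm.toLp g) • (𝓕 F) : Lp ℂ 2 (volume : Measure (Eu d))), ?_, ?_⟩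
  · rw [fourierMultiplierCLM_apply, Lp.fourier_toTemperedDistribution_eq,
      ← Lp.fourierInv_toTemperedDistribution_eq, Lp.toTemperedDistribution_smul_eq hg]
  · rw [FourierTransform.fourier_fourierInv_eq]
    filter_upwards [Lp.coeFn_lpSMul (r := 2) (hm.toLp g) (𝓕 F), hm.coeFn_toLp] with ξ h₁ h₂
    rw [h₁, Pi.smul_apply', h₂, smul_eq_mul]

namespace IsDyadic

variable {R : ℕ} {B : ℝ} {a : ℕ → Eu d → ℂ}

theorem fourier_ae_eq (ha : IsDyadic R B a) {p : ℕ} {F G : Lp ℂ 2 (volume : Measure (Eu d))}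
    (h : fourierMultiplierCLM ℂ (a p) (Lp.toTemperedDistribution F) =
      Lp.toTemperedDistribution G) : ∀ᵐ ξ, 𝓕 G ξ = a p ξ * 𝓕 F ξ := by
  obtain ⟨G', h', hG'⟩ := exists_fourierMultiplierCLM_two (ha.growth p) (ha.bound p) F
  rwa [← toTemperedDistribution_injective (h'.symm.trans h)]

/-- By Plancherel this reduces to the pointwise bound on `∑ |a_p(ξ)|²`. -/
theorem sum_norm_sq_le (ha : IsDyadic R B a) {F : Lp ℂ 2 (volume : Measure (Eu d))}
    {G : ℕ → Lp ℂ 2 (volume : Measure (Eu d))}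
    (h : ∀ p, fourierMultiplierCLM ℂ (a p) (Lp.toTemperedDistribution F) =
      Lp.toTemperedDistribution (G p)) (P : Finset ℕ) :
    ∑ p ∈ P, ‖G p‖ ^ 2 ≤ (4 * R + 1) * B ^ 2 * ‖F‖ ^ 2 := by
  have e (p : ℕ) : ‖G p‖ ^ 2 = ∫ ξ, ‖𝓕 (G p) ξ‖ ^ 2 := by
    rw [← norm_sq_eq_integral, Lp.norm_fourier_eq]
  simp only [e]
  rw [← integral_finsetSum _ fun p _ => integrable_norm_sq _, ← Lp.norm_fourier_eq F,
    norm_sq_eq_integral, ← integral_const_mul]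
  refine integral_mono_ae (integrable_finsetSum _ fun p _ => integrable_norm_sq _)
    ((integrable_norm_sq _).const_mul _) ?_
  filter_upwards [ae_all_iff.2 fun p => ha.fourier_ae_eq (h p)] with ξ hξ
  simp only [hξ, norm_mul, mul_pow]
  rw [← Finset.sum_mul]
  gcongr
  exact ha.sum_sq_le P ξ

/-- The dual bound: Cauchy–Schwarz in `p` at each frequency, then Plancherel. -/
theorem norm_sum_sq_le (ha : IsDyadic R B a) {F G : ℕ → Lp ℂ 2 (volume : Measure (Eu d))}
    (h : ∀ p, fourierMultiplierCLM ℂ (a p) (Lp.toTemperedDistribution (F p)) =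
      Lp.toTemperedDistribution (G p)) (P : Finset ℕ) :
    ‖∑ p ∈ P, G p‖ ^ 2 ≤ (4 * R + 1) * B ^ 2 * ∑ p ∈ P, ‖F p‖ ^ 2 := by
  have e (p : ℕ) : ‖F p‖ ^ 2 = ∫ ξ, ‖𝓕 (F p) ξ‖ ^ 2 := by
    rw [← norm_sq_eq_integral, Lp.norm_fourier_eq]
  simp only [e]
  rw [← integral_finsetSum _ fun p _ => integrable_norm_sq _, ← Lp.norm_fourier_eq,
    norm_sq_eq_integral, ← integral_const_mul]
  refine integral_mono_ae (integrable_norm_sq _)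
    ((integrable_finsetSum _ fun p _ => integrable_norm_sq _).const_mul _) ?_
  have hsum : 𝓕 (∑ p ∈ P, G p) = ∑ p ∈ P, 𝓕 (G p) :=
    map_sum (Lp.fourierTransformₗᵢ (Eu d) ℂ) G P
  filter_upwards [ae_all_iff.2 fun p => ha.fourier_ae_eq (h p),
    Lp.coeFn_finsetSum P fun p => 𝓕 (G p)] with ξ hξ hs
  rw [hsum, hs, Finset.sum_apply]
  simp only [hξ]
  calc ‖∑ p ∈ P, a p ξ * 𝓕 (F p) ξ‖ ^ 2
      ≤ (∑ p ∈ P, ‖a p ξ‖ * ‖𝓕 (F p) ξ‖) ^ 2 := by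
        gcongr
        exact (norm_sum_le _ _).trans_eq (by simp only [norm_mul])
    _ ≤ (∑ p ∈ P, ‖a p ξ‖ ^ 2) * ∑ p ∈ P, ‖𝓕 (F p) ξ‖ ^ 2 := Finset.sum_mul_sq_le_sq_mul_sq _ _ _
    _ ≤ _ := by
      gcongr
      exact ha.sum_sq_le P ξ

/-- Almost orthogonality over finite sets far out in the index makes the partial sums Cauchy in
`L²`; the bound passes to the limit. -/
theorem exists_hasSum (ha : IsDyadic R B a) {F G : ℕ → Lp ℂ 2 (volume : Measure (Eu d))}
    (h : ∀ p, fourierMultiplierCLM ℂ (a p) (Lp.toTemperedDistribution (F p)) =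
      Lp.toTemperedDistribution (G p)) {A : ℝ} (hA : ∀ P : Finset ℕ, ∑ p ∈ P, ‖F p‖ ^ 2 ≤ A) :
    ∃ H, HasSum G H ∧ ‖H‖ ^ 2 ≤ (4 * R + 1) * B ^ 2 * A := by
  have hF : Summable fun p => ‖F p‖ ^ 2 :=
    summable_of_sum_le (fun p => by positivity) hA
  have hG : Summable G := by
    rw [summable_iff_vanishing_norm]
    intro ε hε
    set K : ℝ := (4 * R + 1) * B ^ 2
    have hK : 0 ≤ K := by positivity
    obtain ⟨S, hS⟩ := summable_iff_vanishing_norm.1 hF (ε ^ 2 / (K + 1)) (by positivity)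
    refine ⟨S, fun P hP => ?_⟩
    have h1 := (le_abs_self _).trans_lt (hS P hP)
    refine lt_of_pow_lt_pow_left₀ 2 hε.le ((ha.norm_sum_sq_le h P).trans_lt ?_)
    rw [lt_div_iff₀ (by positivity)] at h1
    have : 0 ≤ ∑ p ∈ P, ‖F p‖ ^ 2 := by positivity
    nlinarith
  refine ⟨_, hG.hasSum, ?_⟩
  refine le_of_tendsto (hG.hasSum.norm.pow 2) (.of_forall fun P => ?_)
  refine (ha.norm_sum_sq_le h P).trans ?_
  gcongr
  exact hA P

end IsDyadic

theorem sobolevNorm_of_eq {s : ℝ} {u : 𝓢'(Eu d, ℂ)} {U : Lp ℂ 2 (volume : Measure (Eu d))}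
    (h : besselPotential (Eu d) ℂ s u = Lp.toTemperedDistribution U) :
    sobolevNorm s u = ‖U‖ₑ := by
  rw [sobolevNorm, h, distLpNorm_toTemperedDistribution]

/-- Conjugating a multiplier by a Bessel potential, up to a constant. -/
theorem fourierMultiplierCLM_weighted {g : Eu d → ℂ} (hg : g.HasTemperateGrowth) (c s : ℝ)
    (v : 𝓢'(Eu d, ℂ)) :
    fourierMultiplierCLM ℂ
        (fun ξ => (c : ℂ) * ((((1 + ‖ξ‖ ^ 2) ^ (s / 2) : ℝ) : ℂ) * g ξ)) v =
      (c : ℂ) • besselPotential (Eu d) ℂ s (fourierMultiplierCLM ℂ g v) := by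
  have hb : (fun ξ : Eu d => (((1 + ‖ξ‖ ^ 2) ^ (s / 2) : ℝ) : ℂ)).HasTemperateGrowth := by fun_prop
  rw [besselPotential, fourierMultiplierCLM_fourierMultiplierCLM_apply hg hb,
    ← smul_apply, ← fourierMultiplierCLM_smul (hg.mul hb)]
  congr 2
  ext ξ
  simp only [Pi.smul_apply, Pi.mul_apply, smul_eq_mul]
  ring

theorem fourierMultiplierCLM_besselPotential {g : Eu d → ℂ} (hg : g.HasTemperateGrowth) (s : ℝ)
    (v : 𝓢'(Eu d, ℂ)) :
    besselPotential (Eu d) ℂ s (fourierMultiplierCLM ℂ g v) =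
      fourierMultiplierCLM ℂ g (besselPotential (Eu d) ℂ s v) := by
  have hb : (fun ξ : Eu d => (((1 + ‖ξ‖ ^ 2) ^ (s / 2) : ℝ) : ℂ)).HasTemperateGrowth := by fun_prop
  rw [besselPotential, fourierMultiplierCLM_fourierMultiplierCLM_apply hg hb,
    fourierMultiplierCLM_fourierMultiplierCLM_apply hb hg, mul_comm]

/-- The global paracomposition is bounded on Sobolev spaces. -/
theorem exists_paracomposition_sobolev (Φ : CutoffFamily d) (n N : ℕ) (s m : ℝ) (hm : 0 < m) :
    ∃ K : ℝ, 0 ≤ K ∧ ∀ κ : Eu d ≃ Eu d, ContDiff ℝ 1 κ → ContDiff ℝ 1 κ.symm →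
      (∀ x, m ≤ |(fderiv ℝ κ x).det|) → ∀ u : 𝓢'(Eu d, ℂ), MemSobolev s 2 u →
        ∃ w : 𝓢'(Eu d, ℂ), IsGlobalParacomposition Φ n N κ u w ∧ MemSobolev s 2 w ∧
          sobolevNorm s w ≤ ENNReal.ofReal K * sobolevNorm s u := by
  obtain ⟨B, hB⟩ := Φ.exists_isDyadic_symbol 0
  obtain ⟨B', hB'⟩ := Φ.exists_isDyadic_pieceSymbol n N
  have ha := hB.weighted s
  have hb := hB'.weighted (-s)
  set Ka : ℝ := (4 * (0 + 4 : ℕ) + 1) * (2 ^ ((0 + 4 : ℕ) * |s|) * B) ^ 2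
  set Kb : ℝ := (4 * (n + 4 + N : ℕ) + 1) * (2 ^ ((n + 4 + N : ℕ) * |(-s)|) * B') ^ 2
  have hKa : 0 ≤ Ka := by positivity
  have hKb : 0 ≤ Kb := by positivity
  set A : ℝ := m⁻¹ ^ (1 / 2 : ℝ)
  have hA : 0 ≤ A := by positivity
  refine ⟨√(Kb * (A ^ 2 * Ka)), Real.sqrt_nonneg _, fun κ hκ hκ' hdet u ⟨U, hU⟩ => ?_⟩
  -- With `U = ⟨D⟩^s u`, the function `G p` is `2^{ps} Δ_p u`.
  choose G hG _ using fun p => exists_fourierMultiplierCLM_two (ha.growth p) (ha.bound p) U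
  have hpow (p : ℕ) : (2 : ℝ) ^ (-(p * s)) * (2 : ℝ) ^ (p * s) = 1 := by
    rw [← Real.rpow_add two_pos, neg_add_cancel, Real.rpow_zero]
  have hblock (p : ℕ) : Φ.block 0 p u =
      Lp.toTemperedDistribution ((((2 : ℝ) ^ (-(p * s)) : ℝ) : ℂ) • G p) := by
    rw [← Lp.toTemperedDistributionCLM_apply, map_smul, Lp.toTemperedDistributionCLM_apply, ← hG,
      fourierMultiplierCLM_weighted (hB.growth p), fourierMultiplierCLM_besselPotential
      (hB.growth p), ← hU, besselPotential_besselPotential_apply, add_neg_cancel, smul_smul,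
      ← Complex.ofReal_mul, hpow]
    simp [CutoffFamily.block_eq]
  choose V hV hVn using fun p : ℕ => exists_isComposition hκ hκ' hA
    (fun f => eLpNorm_two_comp_le hκ hm hdet f) ((((2 : ℝ) ^ (-(p * s)) : ℝ) : ℂ) • G p)
  let F (p : ℕ) : Lp ℂ 2 (volume : Measure (Eu d)) := (((2 : ℝ) ^ (p * s) : ℝ) : ℂ) • V p
  have hF (p : ℕ) : ‖F p‖ ≤ A * ‖G p‖ := by
    have h2 : (0 : ℝ) ≤ 2 ^ (p * s) := by positivity
    have h3 : (0 : ℝ) ≤ 2 ^ (-(p * s)) := by positivity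
    have := hVn p
    rw [norm_smul, Complex.norm_real, Real.norm_of_nonneg h3] at this
    rw [norm_smul, Complex.norm_real, Real.norm_of_nonneg h2]
    calc (2 : ℝ) ^ (p * s) * ‖V p‖ ≤ 2 ^ (p * s) * (A * (2 ^ (-(p * s)) * ‖G p‖)) := by gcongr
      _ = A * ‖G p‖ * (2 ^ (-(p * s)) * 2 ^ (p * s)) := by ring
      _ = A * ‖G p‖ := by rw [hpow, mul_one]
  have hFsum (P : Finset ℕ) : ∑ p ∈ P, ‖F p‖ ^ 2 ≤ A ^ 2 * (Ka * ‖U‖ ^ 2) := by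
    calc ∑ p ∈ P, ‖F p‖ ^ 2 ≤ ∑ p ∈ P, A ^ 2 * ‖G p‖ ^ 2 := by
          gcongr with p
          rw [← mul_pow]
          gcongr
          exact hF p
      _ = A ^ 2 * ∑ p ∈ P, ‖G p‖ ^ 2 := by rw [Finset.mul_sum]
      _ ≤ _ := by gcongr; exact ha.sum_norm_sq_le hG P
  -- The weights cancel those of `F p`: `H p` is `⟨D⟩^s [u_p ∘ κ]_p`, so `⟨D⟩^{-s} ∑ H p` is the
  -- paracomposition.
  choose H hH _ using fun p => exists_fourierMultiplierCLM_two (hb.growth p) (hb.bound p) (F p)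
  obtain ⟨W, hW, hWn⟩ := hb.exists_hasSum hH hFsum
  have hpiece (p : ℕ) : besselPotential (Eu d) ℂ (-s) (Lp.toTemperedDistribution (H p)) =
      piece Φ n N p (Lp.toTemperedDistribution (V p)) := by
    rw [← hH, fourierMultiplierCLM_weighted (hB'.growth p), neg_neg, map_smul,
      besselPotential_besselPotential_apply, add_neg_cancel, besselPotential_zero,
      ContinuousLinearMap.id_apply, ← Lp.toTemperedDistributionCLM_apply, map_smul, map_smul,
      smul_smul, ← Complex.ofReal_mul, mul_neg, hpow, Complex.ofReal_one, one_smul,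
      CutoffFamily.piece_eq, Lp.toTemperedDistributionCLM_apply]
  have hw : besselPotential (Eu d) ℂ s (besselPotential (Eu d) ℂ (-s)
      (Lp.toTemperedDistribution W)) = Lp.toTemperedDistribution W := by
    simp
  refine ⟨besselPotential (Eu d) ℂ (-s) (Lp.toTemperedDistribution W),
    ⟨_, fun p => hblock p ▸ hV p, ?_⟩, ⟨W, hw⟩, ?_⟩
  · have h1 := (hW.map (Lp.toTemperedDistributionCLM ℂ (volume : Measure (Eu d)) 2)
      (ContinuousLinearMap.continuous _)).map (besselPotential (Eu d) ℂ (-s))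
      (ContinuousLinearMap.continuous _)
    refine h1.congr_fun fun p => ?_
    simp only [Function.comp_apply, Lp.toTemperedDistributionCLM_apply, hpiece]
  · rw [sobolevNorm_of_eq hw, sobolevNorm_of_eq hU, ← ofReal_norm, ← ofReal_norm,
      ← ENNReal.ofReal_mul (Real.sqrt_nonneg _)]
    refine ENNReal.ofReal_le_ofReal ?_
    refine le_of_sq_le_sq ?_ (by positivity)
    rw [mul_pow, Real.sq_sqrt (by positivity)]
    exact hWn.trans_eq (by ring)

end Paracomp

end

theorem mainTheorem6 (d : ℕ) (Φ : Paracomp.CutoffFamily d) (n₀ N : ℝ → ℝ → ℕ) (s : ℝ) :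
    ∃ F : ℝ → ℝ → ℝ≥0, ∀ (κ : Paracomp.Eu d ≃ Paracomp.Eu d) (m₀ L : ℝ),
      ContDiff ℝ 1 κ → ContDiff ℝ 1 κ.symm →
      IsLUB (Set.range fun x => ‖fderiv ℝ κ x‖) L →
      0 < m₀ → (∀ x, m₀ ≤ |(fderiv ℝ κ x).det|) →
      (∀ u : 𝓢'(Paracomp.Eu d, ℂ), Paracomp.zygmundNorm Φ 0 s u < ⊤ →
        ∃ w : 𝓢'(Paracomp.Eu d, ℂ),
          Paracomp.IsGlobalParacomposition Φ (n₀ m₀ L) (N m₀ L) κ u w ∧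
          (∀ w', Paracomp.IsGlobalParacomposition Φ (n₀ m₀ L) (N m₀ L) κ u w' → w' = w) ∧
          Paracomp.zygmundNorm Φ (n₀ m₀ L) s w ≤ F m₀ L * Paracomp.zygmundNorm Φ 0 s u) ∧
      (∀ u : 𝓢'(Paracomp.Eu d, ℂ), MemSobolev s 2 u →
        ∃ w : 𝓢'(Paracomp.Eu d, ℂ),
          Paracomp.IsGlobalParacomposition Φ (n₀ m₀ L) (N m₀ L) κ u w ∧
          (∀ w', Paracomp.IsGlobalParacomposition Φ (n₀ m₀ L) (N m₀ L) κ u w' → w' = w) ∧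
          MemSobolev s 2 w ∧
          Paracomp.sobolevNorm s w ≤ F m₀ L * Paracomp.sobolevNorm s u) := by
  choose K₁ _ h₁ using fun m L => Paracomp.exists_paracomposition_zygmund Φ (n₀ m L) (N m L) s
  choose K₂ _ h₂ using fun (m L : ℝ) (hm : 0 < m) =>
    Paracomp.exists_paracomposition_sobolev Φ (n₀ m L) (N m L) s m hm
  -- The sum dominates both constants; the `L²` one exists only for `m > 0`, and `0` is a default
  -- elsewhere.
  refine ⟨fun m L => if hm : 0 < m then (K₁ m L).toNNReal + (K₂ m L hm).toNNReal else 0,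
    fun κ m₀ L hκ hκ' _ hm hdet => ⟨fun u hu => ?_, fun u hu => ?_⟩⟩
  · obtain ⟨w, hw, hn⟩ := h₁ m₀ L κ hκ hκ' u hu
    refine ⟨w, hw, fun w' hw' => hw.unique hκ hκ' hw', hn.trans ?_⟩
    simp only [dif_pos hm, ENNReal.coe_add]
    gcongr
    exact le_self_add
  · obtain ⟨w, hw, hmem, hn⟩ := h₂ m₀ L hm κ hκ hκ' hdet u hu
    refine ⟨w, hw, fun w' hw' => hw.unique hκ hκ' hw', hmem, hn.trans ?_⟩
    simp only [dif_pos hm, ENNReal.coe_add]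
    gcongr
    exact le_add_self
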